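/- Let $E$ be a complex Banach lattice, that is, the complexification $E = X \oplus iX$ of a real Banach lattice $X$, with modulus $|x+iy| = \sup_{\theta\in\mathbb{R}} \big((\cos\theta)\,x + (\sin\theta)\,y\big)$, norm $\|z\| = \|\,|z|\,\|_X$ and positive cone $E_+ = X_+$. For $u \in E_+$ let $E_u = \{f \in E : |f| \le c\,u \text{ for some real } c \ge 0\}$ be the principal ideal generated by $u$, and $\overline{E_u}$ its norm closure. Let $T : E \to E$ be a linear operator such that 1. $T$ is positive: $Tf \in E_+$ for all $f \in E_+$; 2. $T$ is weakly almost periodic: for every $f \in E$ the orbit $\{T^n f : n \ge 0\}$ is relatively compact in the weak topology of $E$; 3. $T$ is irreducible: for every non-zero $f \in E_+$ and every non-zero positive functional $\varphi$ in the norm dual of $E$ there exists an integer $n \ge 0$ with $\langle \varphi, T^n f\rangle > 0$; 4. there exists a projection band $B \ne \{0\}$ in $E$ (a vector subspace that is the range of a bounded linear projection $P$ on $E$ with $0 \le Pf \le f$ for all $f \in E_+$) such that $\overline{E_{Tf}} \supseteq \overline{E_f}$ for every $0 \le f \in B$. Then $\sigma_{\mathrm{pnt}}(T) \cap \mathbb{T}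 \subseteq \{1\}$, i.e. every eigenvalue $\lambda \in \mathbb{C}$ of $T$ with $|\lambda| = 1$ is equal to $1$. -/

import Mathlib

open scoped ComplexOrder

/-- The complexification `X ⊕ iX` of a real vector space `X`. When `X` is a real Banach lattice,
this becomes the complex Banach lattice with real part `X`: see the order, the modulus and the norm
below. -/
@[ext]
structure LatticeComplexification (X : Type*) where
  re : X
  im : X

namespace LatticeComplexification

section Algebra

variable {X : Type*} [AddCommGroup X]

instance : Zero (LatticeComplexification X) := ⟨⟨0, 0⟩⟩
instance : Add (LatticeComplexification X) := ⟨fun z w => ⟨z.re + w.re, z.im + w.im⟩⟩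
instance : Neg (LatticeComplexification X) := ⟨fun z => ⟨-z.re, -z.im⟩⟩
instance : Sub (LatticeComplexification X) := ⟨fun z w => ⟨z.re - w.re, z.im - w.im⟩⟩

@[simp] theorem zero_re : (0 : LatticeComplexification X).re = 0 := rfl
@[simp] theorem zero_im : (0 : LatticeComplexification X).im = 0 := rfl
@[simp] theorem add_re (z w : LatticeComplexification X) : (z + w).re = z.re + w.re := rfl
@[simp] theorem add_im (z w : LatticeComplexification X) : (z + w).im = z.im + w.im := rfl
@[simp] theorem neg_re (z : LatticeComplexification X) : (-z).re = -z.re := rfl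
@[simp] theorem neg_im (z : LatticeComplexification X) : (-z).im = -z.im := rfl
@[simp] theorem sub_re (z w : LatticeComplexification X) : (z - w).re = z.re - w.re := rfl
@[simp] theorem sub_im (z w : LatticeComplexification X) : (z - w).im = z.im - w.im := rfl

instance : AddCommGroup (LatticeComplexification X) where
  add_assoc a b c := by ext <;> simp [add_assoc]
  zero_add a := by ext <;> simp
  add_zero a := by ext <;> simp
  add_comm a b := by ext <;> simp [add_comm]
  neg_add_cancel a := by ext <;> simp
  sub_eq_add_neg a b := by ext <;> simp [sub_eq_add_neg]
  nsmul := nsmulRec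
  zsmul := zsmulRec

variable [Module ℝ X]

/-- `(a + ib)(x + iy) = (ax - by) + i(ay + bx)`. -/
instance : SMul ℂ (LatticeComplexification X) :=
  ⟨fun c z => ⟨c.re • z.re - c.im • z.im, c.re • z.im + c.im • z.re⟩⟩

@[simp] theorem smul_re (c : ℂ) (z : LatticeComplexification X) :
    (c • z).re = c.re • z.re - c.im • z.im := rfl
@[simp] theorem smul_im (c : ℂ) (z : LatticeComplexification X) :
    (c • z).im = c.re • z.im + c.im • z.re := rfl

instance : Module ℂ (LatticeComplexification X) where
  one_smul z := by ext <;> simp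
  mul_smul a b z := by
    ext
    · simp only [smul_re, smul_im, Complex.mul_re, Complex.mul_im]; module
    · simp only [smul_re, smul_im, Complex.mul_re, Complex.mul_im]; module
  smul_zero a := by ext <;> simp
  smul_add a z w := by
    ext
    · simp only [smul_re, add_re, add_im]; module
    · simp only [smul_im, add_re, add_im]; module
  add_smul a b z := by
    ext
    · simp only [smul_re, add_re, Complex.add_re, Complex.add_im]; module
    · simp only [smul_im, add_im, Complex.add_re, Complex.add_im]; module
  zero_smul z := by ext <;> simp

/-- The inclusion of the real part `X` into `X ⊕ iX`. -/
def ofReal (x : X) : LatticeComplexification X := ⟨x, 0⟩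

/-- The order whose positive cone is the cone `X₊` of the real part: `z ≤ w` if and only if
`w - z` lies in the real part and is positive there. -/
instance [PartialOrder X] : PartialOrder (LatticeComplexification X) where
  le z w := z.re ≤ w.re ∧ z.im = w.im
  le_refl z := ⟨le_rfl, rfl⟩
  le_trans _ _ _ h k := ⟨h.1.trans k.1, h.2.trans k.2⟩
  le_antisymm _ _ h k := LatticeComplexification.ext (h.1.antisymm k.1) h.2

end Algebra

section BanachLattice

variable {X : Type*} [NormedAddCommGroup X] [NormedSpace ℝ X] [CompleteSpace X] [Lattice X]
  [IsOrderedAddMonoid X] [IsOrderedModule ℝ X] [HasSolidNorm X]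

/-- The set of all `Re (c z)` with `|c| = 1`, that is, of all `(cos θ) x + (sin θ) y`
for `z = x + iy`. -/
def rotations (z : LatticeComplexification X) : Set X :=
  {x | ∃ c : ℂ, ‖c‖ = 1 ∧ x = (c • z).re}

theorem smul_le_smul_abs {a r : ℝ} (h : |a| ≤ r) (x : X) : a • x ≤ r • |x| := by
  have hr : |a| • |x| ≤ r • |x| := smul_le_smul_of_nonneg_right h (abs_nonneg _)
  refine le_trans ?_ hr
  rcases le_total 0 a with ha | ha
  · rw [abs_of_nonneg ha]
    exact smul_le_smul_of_nonneg_left (le_abs_self x) ha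
  · rw [abs_of_nonpos ha, ← neg_smul_neg]
    exact smul_le_smul_of_nonneg_left (neg_le_abs x) (neg_nonneg.2 ha)

theorem re_smul_le (z : LatticeComplexification X) (c d : ℂ) :
    (c • z).re ≤ (d • z).re + ‖c - d‖ • (|z.re| + |z.im|) := by
  have h1 : (c.re - d.re) • z.re ≤ ‖c - d‖ • |z.re| :=
    smul_le_smul_abs (by simpa using Complex.abs_re_le_norm (c - d)) _
  have h2 : (d.im - c.im) • z.im ≤ ‖c - d‖ • |z.im| := by
    rw [norm_sub_rev]
    exact smul_le_smul_abs (by simpa using Complex.abs_im_le_norm (d - c)) _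
  have h3 : (c • z).re = (d • z).re + ((c.re - d.re) • z.re + (d.im - c.im) • z.im) := by
    simp only [smul_re]; module
  rw [h3, smul_add]
  gcongr

/-- In a Banach lattice the supremum defining the modulus always exists. -/
theorem exists_isLUB_rotations (z : LatticeComplexification X) :
    ∃ m : X, IsLUB (rotations z) m := by
  set u : X := |z.re| + |z.im| with hu
  have hu0 : 0 ≤ u := add_nonneg (abs_nonneg _) (abs_nonneg _)
  let S : Set ℂ := Metric.sphere (0 : ℂ) 1
  have : Nonempty S := ⟨⟨1, by simp [S]⟩⟩
  let d : ℕ → S := TopologicalSpace.denseSeq S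
  have hd : DenseRange d := TopologicalSpace.denseRange_denseSeq S
  let f : ℕ → X := fun n => ((d n : ℂ) • z).re
  let M : ℕ →o X := partialSups f
  have key : ∀ ε : ℝ, 0 < ε → ∃ N, ∀ c : ℂ, ‖c‖ = 1 → (c • z).re ≤ M N + ε • u := by
    intro ε hε
    obtain ⟨t, ht⟩ := (isCompact_univ (X := S)).elim_finite_subcover
      (fun n : ℕ => Metric.ball (d n) ε) (fun n => Metric.isOpen_ball) (by
        intro c _
        obtain ⟨n, hn⟩ := hd.exists_dist_lt c hε
        exact Set.mem_iUnion.2 ⟨n, by simpa using hn⟩)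
    refine ⟨t.sup id, fun c hc => ?_⟩
    have hcS : c ∈ S := by simpa [S] using hc
    obtain ⟨n, hn⟩ := Set.mem_iUnion.1 (ht (Set.mem_univ (⟨c, hcS⟩ : S)))
    obtain ⟨hnt, hn⟩ := Set.mem_iUnion.1 hn
    have hlt : ‖c - (d n : ℂ)‖ < ε := by
      rw [← dist_eq_norm]
      simpa [Subtype.dist_eq] using hn
    calc (c • z).re ≤ f n + ‖c - (d n : ℂ)‖ • u := re_smul_le z c _
      _ ≤ M (t.sup id) + ε • u := by
        refine add_le_add ?_ (smul_le_smul_of_nonneg_right hlt.le hu0)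
        exact le_partialSups_of_le f (Finset.le_sup (f := id) hnt)
  have hbound : ∀ ε : ℝ, 0 < ε → ∃ N, ∀ n, M n ≤ M N + ε • u := by
    intro ε hε
    obtain ⟨N, hN⟩ := key ε hε
    exact ⟨N, fun n => partialSups_le f n _ fun i _ => hN _ (by simp)⟩
  have hC : CauchySeq (fun n => M n) := by
    rw [Metric.cauchySeq_iff']
    intro ε hε
    have hpos : 0 < ‖u‖ + 1 := by positivity
    obtain ⟨N, hN⟩ := hbound (ε / (‖u‖ + 1)) (by positivity)
    refine ⟨N, fun n hn => ?_⟩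
    rw [dist_eq_norm]
    have h0 : 0 ≤ M n - M N := sub_nonneg.2 (M.monotone hn)
    have h1 : M n - M N ≤ (ε / (‖u‖ + 1)) • u := sub_le_iff_le_add'.2 (hN n)
    have h2 : ‖M n - M N‖ ≤ ‖(ε / (‖u‖ + 1)) • u‖ := by
      refine norm_le_norm_of_abs_le_abs ?_
      rwa [abs_of_nonneg h0, abs_of_nonneg (h0.trans h1)]
    refine h2.trans_lt ?_
    rw [norm_smul, Real.norm_of_nonneg (by positivity), div_mul_eq_mul_div, div_lt_iff₀ hpos]
    nlinarith [norm_nonneg u]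
  obtain ⟨m, hm⟩ := cauchySeq_tendsto_of_complete hC
  have hMm : ∀ n, M n ≤ m := fun n => M.monotone.ge_of_tendsto hm n
  refine ⟨m, ?_, ?_⟩
  · rintro _ ⟨c, hc, rfl⟩
    have hε : ∀ k : ℕ, (c • z).re ≤ m + (1 / ((k : ℝ) + 1)) • u := by
      intro k
      obtain ⟨N, hN⟩ := key (1 / ((k : ℝ) + 1)) (by positivity)
      exact (hN c hc).trans (add_le_add (hMm N) le_rfl)
    have hlim : Filter.Tendsto (fun k : ℕ => m + (1 / ((k : ℝ) + 1)) • u) Filter.atTop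
        (nhds (m + (0 : ℝ) • u)) :=
      (tendsto_one_div_add_atTop_nhds_zero_nat.smul_const u).const_add m
    rw [zero_smul, add_zero] at hlim
    exact ge_of_tendsto' hlim hε
  · intro b hb
    exact le_of_tendsto' hm fun n =>
      partialSups_le f n _ fun i _ => hb ⟨_, by simp, rfl⟩

/-- The modulus `|x + iy| = sup {(cos θ) x + (sin θ) y : θ ∈ ℝ}`. -/
noncomputable def modulus (z : LatticeComplexification X) : X :=
  Classical.choose (exists_isLUB_rotations z)

theorem isLUB_modulus (z : LatticeComplexification X) : IsLUB (rotations z) (modulus z) :=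
  Classical.choose_spec (exists_isLUB_rotations z)

theorem re_smul_le_modulus (z : LatticeComplexification X) {c : ℂ} (hc : ‖c‖ = 1) :
    (c • z).re ≤ modulus z :=
  (isLUB_modulus z).1 ⟨c, hc, rfl⟩

theorem abs_re_le_modulus (z : LatticeComplexification X) : |z.re| ≤ modulus z := by
  refine abs_le'.2 ⟨?_, ?_⟩
  · simpa using re_smul_le_modulus z (c := 1) (by simp)
  · simpa using re_smul_le_modulus z (c := -1) (by simp)

theorem abs_im_le_modulus (z : LatticeComplexification X) : |z.im| ≤ modulus z := by
  refine abs_le'.2 ⟨?_, ?_⟩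
  · simpa using re_smul_le_modulus z (c := -Complex.I) (by simp)
  · simpa using re_smul_le_modulus z (c := Complex.I) (by simp)

theorem modulus_nonneg (z : LatticeComplexification X) : 0 ≤ modulus z :=
  (abs_nonneg _).trans (abs_re_le_modulus z)

theorem modulus_add_le (z w : LatticeComplexification X) :
    modulus (z + w) ≤ modulus z + modulus w := by
  refine (isLUB_modulus (z + w)).2 ?_
  rintro _ ⟨c, hc, rfl⟩
  rw [smul_add, add_re]
  exact add_le_add (re_smul_le_modulus z hc) (re_smul_le_modulus w hc)

theorem modulus_smul_le (a : ℂ) (z : LatticeComplexification X) :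
    modulus (a • z) ≤ ‖a‖ • modulus z := by
  refine (isLUB_modulus (a • z)).2 ?_
  rintro _ ⟨c, hc, rfl⟩
  rcases eq_or_ne a 0 with rfl | ha
  · simp
  have ha' : ‖a‖ ≠ 0 := norm_ne_zero_iff.2 ha
  have h1 : c • a • z = ((‖a‖ : ℝ) : ℂ) • ((c * a / (‖a‖ : ℝ)) • z) := by
    rw [smul_smul, smul_smul]
    congr 1
    field_simp [Complex.ofReal_ne_zero.2 ha']
  have h2 : ‖c * a / ((‖a‖ : ℝ) : ℂ)‖ = 1 := by
    simp [hc, ha]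
  rw [h1, smul_re]
  simpa using smul_le_smul_of_nonneg_left (re_smul_le_modulus z h2) (norm_nonneg a)

theorem modulus_smul (a : ℂ) (z : LatticeComplexification X) :
    modulus (a • z) = ‖a‖ • modulus z := by
  refine (modulus_smul_le a z).antisymm ?_
  rcases eq_or_ne a 0 with rfl | ha
  · simpa using modulus_nonneg _
  have ha' : ‖a‖ ≠ 0 := norm_ne_zero_iff.2 ha
  have h := modulus_smul_le a⁻¹ (a • z)
  rw [smul_smul, inv_mul_cancel₀ ha, one_smul, norm_inv] at h
  have h' := smul_le_smul_of_nonneg_left h (norm_nonneg a)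
  rwa [smul_smul, mul_inv_cancel₀ ha', one_smul] at h'

/-- The norm `‖z‖ = ‖ |z| ‖` of the complex Banach lattice. -/
noncomputable instance : Norm (LatticeComplexification X) := ⟨fun z => ‖modulus z‖⟩

theorem norm_def (z : LatticeComplexification X) : ‖z‖ = ‖modulus z‖ := rfl

theorem normedSpaceCore : NormedSpace.Core ℂ (LatticeComplexification X) where
  norm_nonneg z := norm_nonneg (modulus z)
  norm_smul c z := by
    rw [norm_def, norm_def, modulus_smul, norm_smul, norm_norm]
  norm_triangle z w := by
    simp only [norm_def]
    refine le_trans (norm_le_norm_of_abs_le_abs ?_) (norm_add_le _ _)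
    rw [abs_of_nonneg (modulus_nonneg _),
      abs_of_nonneg (add_nonneg (modulus_nonneg _) (modulus_nonneg _))]
    exact modulus_add_le z w
  norm_eq_zero_iff z := by
    constructor
    · intro h
      have h0 : modulus z = 0 := norm_eq_zero.1 h
      have h1 := abs_re_le_modulus z
      have h2 := abs_im_le_modulus z
      rw [h0] at h1 h2
      have h3 : ∀ x : X, |x| ≤ 0 → x = 0 := fun x hx =>
        le_antisymm ((le_abs_self x).trans hx) (neg_nonpos.1 ((neg_le_abs x).trans hx))
      exact LatticeComplexification.ext (h3 _ h1) (h3 _ h2)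
    · rintro rfl
      have h := modulus_smul (0 : ℂ) (0 : LatticeComplexification X)
      rw [smul_zero, norm_zero, zero_smul] at h
      rw [norm_def, h, norm_zero]

noncomputable instance : NormedAddCommGroup (LatticeComplexification X) :=
  NormedAddCommGroup.ofCore normedSpaceCore

noncomputable instance : NormedSpace ℂ (LatticeComplexification X) :=
  NormedSpace.ofCore normedSpaceCore

theorem norm_re_le (z : LatticeComplexification X) : ‖z.re‖ ≤ ‖z‖ := by
  refine norm_le_norm_of_abs_le_abs ?_
  rw [abs_of_nonneg (modulus_nonneg z)]
  exact abs_re_le_modulus z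

theorem norm_im_le (z : LatticeComplexification X) : ‖z.im‖ ≤ ‖z‖ := by
  refine norm_le_norm_of_abs_le_abs ?_
  rw [abs_of_nonneg (modulus_nonneg z)]
  exact abs_im_le_modulus z

theorem modulus_le (z : LatticeComplexification X) : modulus z ≤ |z.re| + |z.im| := by
  refine (isLUB_modulus z).2 ?_
  rintro _ ⟨c, hc, rfl⟩
  simpa [hc] using re_smul_le z c 0

theorem norm_le_add (z : LatticeComplexification X) : ‖z‖ ≤ ‖z.re‖ + ‖z.im‖ := by
  rw [norm_def, ← norm_abs_eq_norm z.re, ← norm_abs_eq_norm z.im]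
  refine le_trans (norm_le_norm_of_abs_le_abs ?_) (norm_add_le _ _)
  rw [abs_of_nonneg (modulus_nonneg z), abs_of_nonneg (by positivity)]
  exact modulus_le z

instance : CompleteSpace (LatticeComplexification X) := by
  refine Metric.complete_of_cauchySeq_tendsto fun u hu => ?_
  rw [Metric.cauchySeq_iff'] at hu
  have h1 : CauchySeq fun n => (u n).re := by
    rw [Metric.cauchySeq_iff']
    intro ε hε
    obtain ⟨N, h⟩ := hu ε hε
    refine ⟨N, fun n hn => lt_of_le_of_lt ?_ (h n hn)⟩
    rw [dist_eq_norm, dist_eq_norm]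
    exact norm_re_le (u n - u N)
  have h2 : CauchySeq fun n => (u n).im := by
    rw [Metric.cauchySeq_iff']
    intro ε hε
    obtain ⟨N, h⟩ := hu ε hε
    refine ⟨N, fun n hn => lt_of_le_of_lt ?_ (h n hn)⟩
    rw [dist_eq_norm, dist_eq_norm]
    exact norm_im_le (u n - u N)
  obtain ⟨a, ha⟩ := cauchySeq_tendsto_of_complete h1
  obtain ⟨b, hb⟩ := cauchySeq_tendsto_of_complete h2
  refine ⟨⟨a, b⟩, tendsto_iff_norm_sub_tendsto_zero.2 ?_⟩
  refine squeeze_zero (fun _ => norm_nonneg _) (fun n => norm_le_add _) ?_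
  simpa using (tendsto_iff_norm_sub_tendsto_zero.1 ha).add
    (tendsto_iff_norm_sub_tendsto_zero.1 hb)

/-- The principal ideal `E_u = {f : ∃ c ≥ 0, |f| ≤ c u}` generated by `u ∈ E₊`. -/
def principalIdeal (u : LatticeComplexification X) : Set (LatticeComplexification X) :=
  {f | ∃ c : ℝ, 0 ≤ c ∧ ofReal (modulus f) ≤ (c : ℂ) • u}

/-- `T` maps the positive cone into itself. -/
def IsPositiveOperator
    (T : LatticeComplexification X →ₗ[ℂ] LatticeComplexification X) : Prop :=
  ∀ f, 0 ≤ f → 0 ≤ T f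

/-- For all non-zero `f ∈ E₊` and all non-zero positive functionals `φ` in the norm dual there is
`n ≥ 0` with `⟨φ, Tⁿ f⟩ > 0`. Here `0 ≤ w` and `0 < w`, for complex `w`, include that `w` is
real. -/
def IsIrreducibleOperator
    (T : LatticeComplexification X →ₗ[ℂ] LatticeComplexification X) : Prop :=
  ∀ f : LatticeComplexification X, 0 ≤ f → f ≠ 0 →
    ∀ φ : LatticeComplexification X →L[ℂ] ℂ, (∀ g, 0 ≤ g → 0 ≤ φ g) → φ ≠ 0 →
      ∃ n : ℕ, 0 < φ ((T ^ n) f)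

/-- `B` is the range of a bounded linear projection `P` with `0 ≤ P f ≤ f` for all `f ∈ E₊`. -/
def IsProjectionBand (B : Submodule ℂ (LatticeComplexification X)) : Prop :=
  ∃ P : LatticeComplexification X →L[ℂ] LatticeComplexification X,
    (∀ f, P (P f) = P f) ∧ P.range = B ∧ ∀ f, 0 ≤ f → 0 ≤ P f ∧ P f ≤ f

end BanachLattice

end LatticeComplexification

/-- Every orbit `{Tⁿ f : n ≥ 0}` is relatively compact in the weak topology. -/
def IsWeaklyAlmostPeriodic {E : Type*} [NormedAddCommGroup E] [NormedSpace ℂ E]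
    (T : E →ₗ[ℂ] E) : Prop :=
  ∀ f : E, IsCompact (closure (Set.range fun n : ℕ => toWeakSpace ℂ E ((T ^ n) f)))

/-! Let `T z = μ • z` with `|μ| = 1`, `μ ≠ 1`; write `u = |z|`, `S` for the action of `T` on `X`,
and `Q` for that of the band projection. Rotating `z` gives `u ≤ S u`. A Cesàro limit of a positive
`ψ` with `ψ u > 0` along the orbits of `S` (bounded by weak compactness) is an `S`-invariant
positive `φ` with `φ u > 0`. It vanishes on the orbit of `S u - u ≥ 0`, so irreducibility forces `S
u = u` (`realPart_modulus_eq`).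

For unimodular `c` put `g_c = (δ u - (u - Re (c z)))⁺`, heuristically the part of `u` where the
phase of `c z` is close to `1`. Since `S` shifts phases by `μ ≠ 1`, for small `δ` the elements `g_c`
and `S g_c` are disjoint (`exists_nearPart_disjoint`). Then `Q g_c` and `S Q g_c` are disjoint too,
whereas the band hypothesis puts `Q g_c` in the closed ideal of `S Q g_c`; so `Q g_c = 0`
(`eq_zero_of_mem_closure_principalIdeal`). Hence `δ Q u ≤ u - Re (c z)` for every `c`, and the
supremum over `c` gives `Q u = 0`. But `Q ≠ 0`, so some nonzero positive functional `ψ ∘ Q` vanishes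
on the whole orbit `S^n u = u`, against irreducibility. -/

/-! ### Positive functionals on normed lattices. -/

section PositiveFunctionals

/-- Dividing by `c + 1` makes the coefficients of both `x` and `y` at most `1`. -/
theorem inf_smul_eq_zero {X : Type*} [AddCommGroup X] [Module ℝ X] [Lattice X]
    [IsOrderedAddMonoid X] [IsOrderedModule ℝ X] {x y : X} (hx : 0 ≤ x) (hy : 0 ≤ y)
    (h : x ⊓ y = 0) {c : ℝ} (hc : 0 ≤ c) : x ⊓ c • y = 0 := by
  refine le_antisymm ?_ (le_inf hx (smul_nonneg hc hy))
  have hc1 : 0 < c + 1 := by linarith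
  have h1 : (c + 1)⁻¹ • (x ⊓ c • y) ≤ x ⊓ y := by
    refine le_inf ?_ ?_
    · refine (smul_le_smul_of_nonneg_left inf_le_left (inv_pos.2 hc1).le).trans ?_
      conv_rhs => rw [← one_smul ℝ x]
      exact smul_le_smul_of_nonneg_right (inv_le_one_of_one_le₀ (by linarith)) hx
    · refine (smul_le_smul_of_nonneg_left inf_le_right (inv_pos.2 hc1).le).trans ?_
      rw [smul_smul]
      conv_rhs => rw [← one_smul ℝ y]
      refine smul_le_smul_of_nonneg_right ?_ hy
      rw [inv_mul_le_iff₀ hc1]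
      linarith
  rw [h] at h1
  have h2 := smul_le_smul_of_nonneg_left h1 hc1.le
  rwa [smul_smul, mul_inv_cancel₀ hc1.ne', one_smul, smul_zero] at h2

theorem norm_le_norm_of_nonneg_of_le {X : Type*} [NormedAddCommGroup X] [Lattice X]
    [IsOrderedAddMonoid X] [HasSolidNorm X] {x y : X} (hx : 0 ≤ x) (hxy : x ≤ y) : ‖x‖ ≤ ‖y‖ := by
  refine norm_le_norm_of_abs_le_abs ?_
  rwa [abs_of_nonneg hx, abs_of_nonneg (hx.trans hxy)]

variable {X : Type*} [NormedAddCommGroup X] [NormedSpace ℝ X] [Lattice X]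
  [IsOrderedAddMonoid X] [IsOrderedModule ℝ X] [HasSolidNorm X]

theorem norm_posPart_smul_le {c : ℝ} (hc : 0 < c) (x : X) : ‖(c • x)⁺‖ ≤ c * ‖x⁺‖ := by
  have h : (c • x)⁺ ≤ c • x⁺ :=
    sup_le (smul_le_smul_of_nonneg_left (le_posPart x) hc.le)
      (smul_nonneg hc.le (posPart_nonneg x))
  simpa [norm_smul, abs_of_pos hc] using norm_le_norm_of_nonneg_of_le (posPart_nonneg _) h

theorem norm_posPart_smul {c : ℝ} (hc : 0 < c) (x : X) : ‖(c • x)⁺‖ = c * ‖x⁺‖ := by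
  refine (norm_posPart_smul_le hc x).antisymm ?_
  have h := norm_posPart_smul_le (inv_pos.2 hc) (c • x)
  rw [smul_smul, inv_mul_cancel₀ hc.ne', one_smul] at h
  rwa [← le_inv_mul_iff₀ hc]

omit [NormedSpace ℝ X] [IsOrderedModule ℝ X] in
theorem norm_posPart_add_le (x y : X) : ‖(x + y)⁺‖ ≤ ‖x⁺‖ + ‖y⁺‖ := by
  have h : (x + y)⁺ ≤ x⁺ + y⁺ :=
    sup_le (add_le_add (le_posPart x) (le_posPart y))
      (add_nonneg (posPart_nonneg x) (posPart_nonneg y))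
  exact (norm_le_norm_of_nonneg_of_le (posPart_nonneg _) h).trans (norm_add_le _ _)

/-- A nonzero positive element of a normed lattice is detected by a positive functional. -/
theorem exists_positive_functional_pos {x : X} (hx : 0 ≤ x) (hx0 : x ≠ 0) :
    ∃ ψ : X →ₗ[ℝ] ℝ, (∀ y, 0 ≤ y → 0 ≤ ψ y) ∧ 0 < ψ x := by
  -- Hahn–Banach with the gauge `‖y⁺‖` instead of `‖y‖`: it vanishes on `-y` for `y ≥ 0`, so
  -- domination by it already forces positivity.
  obtain ⟨g, hg, hgN⟩ := exists_extension_of_le_sublinear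
    (LinearPMap.mkSpanSingleton (K := ℝ) (L := ℝ) (σ := RingHom.id ℝ) x ‖x‖ hx0) (fun y => ‖y⁺‖)
    (fun c hc y => norm_posPart_smul hc y) norm_posPart_add_le (by
      rintro ⟨y, hy⟩
      obtain ⟨c, rfl⟩ := Submodule.mem_span_singleton.1 hy
      have hcx : LinearPMap.mkSpanSingleton (K := ℝ) (L := ℝ) (σ := RingHom.id ℝ) x ‖x‖ hx0
          ⟨c • x, hy⟩ = c * ‖x‖ := LinearPMap.mkSpanSingleton'_apply ..
      rw [hcx]
      rcases le_or_gt c 0 with hc | hc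
      · exact (mul_nonpos_of_nonpos_of_nonneg hc (norm_nonneg x)).trans (norm_nonneg _)
      · show c * ‖x‖ ≤ ‖(c • x)⁺‖
        rw [norm_posPart_smul hc, posPart_of_nonneg hx])
  refine ⟨g, fun y hy => ?_, ?_⟩
  · have h := hgN (-y)
    rw [posPart_of_nonpos (neg_nonpos.2 hy), norm_zero, map_neg] at h
    exact neg_nonpos.1 h
  · have h := hg ⟨x, Submodule.mem_span_singleton_self x⟩
    rw [LinearPMap.mkSpanSingleton_apply ℝ ℝ] at h
    rw [h]
    exact norm_pos_iff.2 hx0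

theorem abs_le_of_positive_functional {X : Type*} [AddCommGroup X] [Module ℝ X] [Lattice X]
    [IsOrderedAddMonoid X] {φ : X →ₗ[ℝ] ℝ} (hφ : ∀ y, 0 ≤ y → 0 ≤ φ y) (x : X) :
    |φ x| ≤ φ |x| := by
  refine abs_le'.2 ⟨?_, ?_⟩
  · have := hφ _ (sub_nonneg.2 (le_abs_self x))
    rw [map_sub] at this
    linarith
  · have := hφ _ (sub_nonneg.2 (neg_le_abs x))
    rw [map_sub, map_neg] at this
    linarith

/-- Positive functionals on Banach lattices are bounded. -/
theorem exists_bound_of_positive_functional [CompleteSpace X] {φ : X →ₗ[ℝ] ℝ}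
    (hφ : ∀ y, 0 ≤ y → 0 ≤ φ y) : ∃ C : ℝ, ∀ x, |φ x| ≤ C * ‖x‖ := by
  by_contra! H
  choose x hx using fun n : ℕ => H (2 ^ n)
  have hlt : ∀ n, 2 ^ n * ‖x n‖ < φ |x n| := fun n =>
    (hx n).trans_le (abs_le_of_positive_functional hφ _)
  have hpos : ∀ n, 0 < φ |x n| := fun n => lt_of_le_of_lt (by positivity) (hlt n)
  -- Normalised to `φ (y n) = 1` while `‖y n‖ ≤ 2⁻ⁿ`: the series converges, yet `φ` of its sum
  -- dominates every `N`.
  let y : ℕ → X := fun n => (φ |x n|)⁻¹ • |x n|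
  have hy0 : ∀ n, 0 ≤ y n := fun n => smul_nonneg (inv_pos.2 (hpos n)).le (abs_nonneg _)
  have hy1 : ∀ n, φ (y n) = 1 := fun n => by
    simp only [y, map_smul, smul_eq_mul]
    exact inv_mul_cancel₀ (hpos n).ne'
  have hyn : ∀ n, ‖y n‖ ≤ (1 / 2) ^ n := fun n => by
    simp only [y, norm_smul, norm_inv, Real.norm_of_nonneg (hpos n).le, norm_abs_eq_norm]
    rw [inv_mul_le_iff₀ (hpos n), one_div, inv_pow, ← div_eq_mul_inv, le_div_iff₀ (by positivity)]
    linarith [hlt n]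
  have hs : Summable y := Summable.of_norm_bounded summable_geometric_two hyn
  obtain ⟨N, hN⟩ := exists_nat_gt (φ (∑' n, y n))
  have h := hφ _ (sub_nonneg.2 (hs.sum_le_tsum (Finset.range N) fun n _ => hy0 n))
  simp only [map_sub, map_sum, hy1, Finset.sum_const, Finset.card_range, nsmul_eq_mul,
    mul_one] at h
  linarith

end PositiveFunctionals

/-! ### Invariant functionals as limits of Cesàro means. -/

section InvariantFunctional

theorem exists_tendsto_hyperfilter_of_bounded {a : ℕ → ℝ} {C : ℝ} (h : ∀ n, |a n| ≤ C) :
    ∃ l, Filter.Tendsto a (Filter.hyperfilter ℕ) (nhds l) := by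
  obtain ⟨l, -, hl⟩ := (isCompact_Icc (a := -C) (b := C)).ultrafilter_le_nhds
    ((Filter.hyperfilter ℕ).map a) (by
      rw [Filter.le_principal_iff]
      exact Filter.Eventually.of_forall (f := (Filter.hyperfilter ℕ : Filter ℕ))
        (p := fun n => a n ∈ Set.Icc (-C) C) fun n => abs_le.1 (h n))
  exact ⟨l, hl⟩

variable {V : Type*} [AddCommGroup V] [Module ℝ V]

/-- An ultrafilter limit of Cesàro means along a linear map with bounded orbits. -/
theorem exists_cesaro_limit_functional (S : V →ₗ[ℝ] V) (ψ : V →ₗ[ℝ] ℝ)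
    (hb : ∀ x, ∃ C, ∀ n : ℕ, |ψ ((S ^ n) x)| ≤ C) :
    ∃ φ : V →ₗ[ℝ] ℝ, (∀ x, φ (S x) = φ x) ∧
      ∀ x a, (∀ n : ℕ, a ≤ ψ ((S ^ n) x)) → a ≤ φ x := by
  let c : ℕ → V →ₗ[ℝ] ℝ := fun n =>
    ((n : ℝ) + 1)⁻¹ • ∑ k ∈ Finset.range (n + 1), ψ ∘ₗ (S ^ k)
  have hc : ∀ n x, c n x = ((n : ℝ) + 1)⁻¹ * ∑ k ∈ Finset.range (n + 1), ψ ((S ^ k) x) := by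
    intro n x
    simp [c]
  have hex : ∀ x, ∃ l, Filter.Tendsto (fun n => c n x) (Filter.hyperfilter ℕ) (nhds l) := by
    intro x
    obtain ⟨C, hC⟩ := hb x
    refine exists_tendsto_hyperfilter_of_bounded (C := C) fun n => ?_
    have hn : (0 : ℝ) < (n : ℝ) + 1 := by positivity
    rw [hc, abs_mul, abs_of_pos (inv_pos.2 hn), inv_mul_le_iff₀ hn]
    refine (Finset.abs_sum_le_sum_abs _ _).trans ?_
    refine (Finset.sum_le_sum fun k _ => hC k).trans_eq ?_
    simp
  choose l hl using hex
  refine ⟨{ toFun := l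
            map_add' := fun x y => tendsto_nhds_unique (hl (x + y))
              (by simpa using (hl x).add (hl y))
            map_smul' := fun r x => tendsto_nhds_unique (hl (r • x))
              (by simpa using (hl x).const_mul r) }, fun x => ?_, fun x a ha => ?_⟩
  -- The difference of the two means telescopes to two boundary terms over `n + 1`; this ordinary
  -- limit passes to the finer hyperfilter.
  · have h0 : Filter.Tendsto (fun n => c n (S x) - c n x) Filter.atTop (nhds 0) := by
      obtain ⟨C, hC⟩ := hb x
      have hlim : Filter.Tendsto (fun n : ℕ => 1 / ((n : ℝ) + 1) * (2 * C)) Filter.atTop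
          (nhds 0) := by
        simpa using tendsto_one_div_add_atTop_nhds_zero_nat.mul_const (2 * C)
      refine squeeze_zero_norm (fun n => ?_) hlim
      have hn : (0 : ℝ) < (n : ℝ) + 1 := by positivity
      have hS : ∀ k, ψ ((S ^ k) (S x)) = ψ ((S ^ (k + 1)) x) := fun k => by
        rw [pow_succ]; rfl
      rw [hc, hc, ← mul_sub, ← Finset.sum_sub_distrib]
      simp only [hS]
      rw [Finset.sum_range_sub (fun k => ψ ((S ^ k) x)), norm_mul, Real.norm_eq_abs,
        Real.norm_eq_abs, abs_of_pos (inv_pos.2 hn), one_div]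
      refine mul_le_mul_of_nonneg_left ?_ (inv_pos.2 hn).le
      refine (abs_sub _ _).trans ?_
      linarith [hC (n + 1), hC 0]
    have h1 := (hl (S x)).sub (hl x)
    exact sub_eq_zero.1 (tendsto_nhds_unique h1 (h0.mono_left Nat.hyperfilter_le_atTop))
  · refine ge_of_tendsto' (hl x) fun n => ?_
    have hn : (0 : ℝ) < (n : ℝ) + 1 := by positivity
    rw [hc, le_inv_mul_iff₀ hn]
    refine le_trans (le_of_eq ?_) (Finset.sum_le_sum fun k _ => ha k)
    simp

end InvariantFunctional

/-! ### Positive operators on the complexification and their real parts. -/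

namespace LatticeComplexification

section OfReal

variable {X : Type*} [AddCommGroup X]

@[simp] theorem ofReal_re (x : X) : (ofReal x).re = x := rfl
@[simp] theorem ofReal_im (x : X) : (ofReal x).im = 0 := rfl

theorem ofReal_add (x y : X) : ofReal (x + y) = ofReal x + ofReal y := by ext <;> simp
theorem ofReal_sub (x y : X) : ofReal (x - y) = ofReal x - ofReal y := by ext <;> simp

theorem ofReal_nonneg [PartialOrder X] {x : X} (hx : 0 ≤ x) : 0 ≤ ofReal x := ⟨hx, rfl⟩

theorem eq_ofReal_of_nonneg [PartialOrder X] {z : LatticeComplexification X} (hz : 0 ≤ z) :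
    z = ofReal z.re :=
  LatticeComplexification.ext rfl hz.2.symm

variable [Module ℝ X]

theorem coe_smul_re (c : ℝ) (z : LatticeComplexification X) : ((c : ℂ) • z).re = c • z.re := by
  rw [smul_re, Complex.ofReal_re, Complex.ofReal_im, zero_smul, sub_zero]

theorem ofReal_smul (c : ℝ) (x : X) : ofReal (c • x) = (c : ℂ) • ofReal x := by
  ext
  · rw [coe_smul_re, ofReal_re, ofReal_re]
  · rw [smul_im, Complex.ofReal_im, ofReal_im, ofReal_im, smul_zero, zero_smul, add_zero]

theorem eq_re_add_im (z : LatticeComplexification X) :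
    z = ofReal z.re + Complex.I • ofReal z.im := by ext <;> simp

/-- The action of an operator on real parts of real elements. -/
def realPart (T : LatticeComplexification X →ₗ[ℂ] LatticeComplexification X) : X →ₗ[ℝ] X where
  toFun x := (T (ofReal x)).re
  map_add' x y := by simp [ofReal_add]
  map_smul' c x := by rw [ofReal_smul, map_smul, coe_smul_re]; rfl

end OfReal

section RealPart

variable {X : Type*} [NormedAddCommGroup X] [NormedSpace ℝ X] [Lattice X]
  {T : LatticeComplexification X →ₗ[ℂ] LatticeComplexification X}

theorem IsPositiveOperator.realPart_nonneg (hT : IsPositiveOperator T) {x : X} (hx : 0 ≤ x) :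
    0 ≤ realPart T x :=
  (hT _ (ofReal_nonneg hx)).1

variable [IsOrderedAddMonoid X]

theorem IsPositiveOperator.realPart_mono (hT : IsPositiveOperator T) {x y : X} (h : x ≤ y) :
    realPart T x ≤ realPart T y := by
  have := hT.realPart_nonneg (sub_nonneg.2 h)
  rwa [map_sub, sub_nonneg] at this

theorem IsPositiveOperator.apply_ofReal (hT : IsPositiveOperator T) (x : X) :
    T (ofReal x) = ofReal (realPart T x) := by
  refine LatticeComplexification.ext rfl ?_
  -- The order on the complexification makes positive elements real, so it suffices to split `x`
  -- into positive and negative parts.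
  have h1 : (T (ofReal x⁺)).im = 0 := (hT _ (ofReal_nonneg (posPart_nonneg x))).2.symm
  have h2 : (T (ofReal x⁻)).im = 0 := (hT _ (ofReal_nonneg (negPart_nonneg x))).2.symm
  conv_lhs => rw [← posPart_sub_negPart x, ofReal_sub, map_sub, sub_im, h1, h2]
  simp

theorem IsPositiveOperator.apply_eq (hT : IsPositiveOperator T) (z : LatticeComplexification X) :
    T z = ⟨realPart T z.re, realPart T z.im⟩ := by
  conv_lhs => rw [eq_re_add_im z, map_add, map_smul, hT.apply_ofReal, hT.apply_ofReal]
  ext <;> simp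

theorem IsPositiveOperator.pow_apply_ofReal (hT : IsPositiveOperator T) (n : ℕ) (x : X) :
    (T ^ n) (ofReal x) = ofReal ((realPart T ^ n) x) := by
  induction n generalizing x with
  | zero => simp
  | succ n ih => rw [pow_succ, pow_succ, Module.End.mul_apply, Module.End.mul_apply,
      hT.apply_ofReal, ih]

theorem IsPositiveOperator.realPart_smul_re (hT : IsPositiveOperator T)
    {z : LatticeComplexification X} {μ : ℂ} (hz : T z = μ • z) (c : ℂ) :
    realPart T (c • z).re = ((c * μ) • z).re := by
  have h : T (c • z) = (c * μ) • z := by rw [map_smul, hz, smul_smul]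
  have h' := congrArg LatticeComplexification.re ((hT.apply_eq (c • z)).symm.trans h)
  exact h'

end RealPart

variable {X : Type*} [NormedAddCommGroup X] [NormedSpace ℝ X] [CompleteSpace X] [Lattice X]
  [IsOrderedAddMonoid X] [IsOrderedModule ℝ X] [HasSolidNorm X]

section Positive

variable {T : LatticeComplexification X →ₗ[ℂ] LatticeComplexification X}

/-- Each rotation is an image: `Re (c z) = S (Re (c μ⁻¹ z)) ≤ S |z|`. -/
theorem IsPositiveOperator.modulus_le_realPart_modulus (hT : IsPositiveOperator T)
    {z : LatticeComplexification X} {μ : ℂ} (hμ : ‖μ‖ = 1) (hz : T z = μ • z) :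
    modulus z ≤ realPart T (modulus z) := by
  have hμ0 : μ ≠ 0 := by rintro rfl; simp at hμ
  refine (isLUB_modulus z).2 ?_
  rintro _ ⟨c, hc, rfl⟩
  have h := hT.realPart_smul_re hz (c * μ⁻¹)
  rw [inv_mul_cancel_right₀ hμ0] at h
  rw [← h]
  exact hT.realPart_mono (re_smul_le_modulus z (by simp [hc, hμ]))

end Positive

/-- The complex-linear extension of a positive functional on the real part. -/
theorem exists_complex_extension {φ : X →ₗ[ℝ] ℝ} (hφ : ∀ x, 0 ≤ x → 0 ≤ φ x) :
    ∃ Φ : LatticeComplexification X →L[ℂ] ℂ, ∀ x, Φ (ofReal x) = φ x := by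
  obtain ⟨C, hC⟩ := exists_bound_of_positive_functional hφ
  have hC' : ∀ x, |φ x| ≤ |C| * ‖x‖ := fun x =>
    (hC x).trans (mul_le_mul_of_nonneg_right (le_abs_self C) (norm_nonneg x))
  let L : LatticeComplexification X →ₗ[ℂ] ℂ :=
    { toFun := fun z => φ z.re + φ z.im * Complex.I
      map_add' := fun z w => by
        simp only [add_re, add_im, map_add, Complex.ofReal_add]
        ring
      map_smul' := fun c z => by
        apply Complex.ext <;> simp }
  refine ⟨L.mkContinuous (|C| + |C|) fun z => ?_, fun x => ?_⟩
  · calc ‖L z‖ ≤ ‖(φ z.re : ℂ)‖ + ‖(φ z.im : ℂ) * Complex.I‖ := norm_add_le _ _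
      _ = |φ z.re| + |φ z.im| := by simp
      _ ≤ |C| * ‖z‖ + |C| * ‖z‖ :=
        add_le_add ((hC' _).trans (mul_le_mul_of_nonneg_left (norm_re_le z) (abs_nonneg C)))
          ((hC' _).trans (mul_le_mul_of_nonneg_left (norm_im_le z) (abs_nonneg C)))
      _ = (|C| + |C|) * ‖z‖ := by ring
  · simp [L]

variable {T : LatticeComplexification X →ₗ[ℂ] LatticeComplexification X}

theorem IsIrreducibleOperator.exists_realPart_pow_pos (hirr : IsIrreducibleOperator T)
    (hT : IsPositiveOperator T) {x : X} (hx : 0 ≤ x) (hx0 : x ≠ 0) {φ : X →ₗ[ℝ] ℝ}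
    (hφ : ∀ x, 0 ≤ x → 0 ≤ φ x) (hφ0 : φ ≠ 0) : ∃ n : ℕ, 0 < φ ((realPart T ^ n) x) := by
  obtain ⟨Φ, hΦ⟩ := exists_complex_extension hφ
  obtain ⟨n, hn⟩ := hirr (ofReal x) (ofReal_nonneg hx)
    (fun h => hx0 (congrArg LatticeComplexification.re h)) Φ
    (fun g hg => by
      rw [eq_ofReal_of_nonneg hg, hΦ]
      exact_mod_cast hφ _ hg.1)
    (by
      rintro rfl
      refine hφ0 (LinearMap.ext fun y => ?_)
      have := hΦ y
      simpa using this.symm)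
  rw [hT.pow_apply_ofReal, hΦ] at hn
  exact ⟨n, by exact_mod_cast hn⟩

/-- The extension of `ψ` is weakly continuous, hence bounded on the weakly compact orbit closure. -/
theorem exists_bound_realPart_pow_of_isWeaklyAlmostPeriodic (hwap : IsWeaklyAlmostPeriodic T)
    (hT : IsPositiveOperator T) {ψ : X →ₗ[ℝ] ℝ} (hψ : ∀ x, 0 ≤ x → 0 ≤ ψ x) (x : X) :
    ∃ C, ∀ n : ℕ, |ψ ((realPart T ^ n) x)| ≤ C := by
  obtain ⟨Ψ, hΨ⟩ := exists_complex_extension hψ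
  have hcont : Continuous fun w : WeakSpace ℂ (LatticeComplexification X) =>
      Ψ ((toWeakSpace ℂ (LatticeComplexification X)).symm w) :=
    WeakBilin.eval_continuous _ Ψ
  obtain ⟨C, hC⟩ := ((hwap (ofReal x)).image hcont).isBounded.exists_norm_le
  refine ⟨C, fun n => ?_⟩
  have h := hC _ ⟨_, subset_closure ⟨n, rfl⟩, rfl⟩
  simpa [hT.pow_apply_ofReal, hΨ] using h

/-- The modulus of an eigenvector to a unimodular eigenvalue is a fixed vector. -/
theorem realPart_modulus_eq (hT : IsPositiveOperator T) (hwap : IsWeaklyAlmostPeriodic T)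
    (hirr : IsIrreducibleOperator T) {z : LatticeComplexification X} {μ : ℂ} (hμ : ‖μ‖ = 1)
    (hz : T z = μ • z) : realPart T (modulus z) = modulus z := by
  have hle := hT.modulus_le_realPart_modulus hμ hz
  by_contra hne
  have hu0 : modulus z ≠ 0 := fun h => hne (by rw [h, map_zero])
  obtain ⟨ψ, hψ, hψu⟩ := exists_positive_functional_pos (modulus_nonneg z) hu0
  have hψmono : ∀ x y, x ≤ y → ψ x ≤ ψ y := fun x y h => by
    have := hψ _ (sub_nonneg.2 h)
    rwa [map_sub, sub_nonneg] at this
  obtain ⟨φ, hφS, hφ⟩ := exists_cesaro_limit_functional (realPart T) ψ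
    (exists_bound_realPart_pow_of_isWeaklyAlmostPeriodic hwap hT hψ)
  have hpow : ∀ n : ℕ, ∀ x, 0 ≤ x → 0 ≤ (realPart T ^ n) x := fun n x hx => by
    induction n with
    | zero => simpa
    | succ n ih =>
      rw [pow_succ', Module.End.mul_apply]
      exact hT.realPart_nonneg ih
  have hpowu : ∀ n : ℕ, modulus z ≤ (realPart T ^ n) (modulus z) := fun n => by
    induction n with
    | zero => simp
    | succ n ih =>
      rw [pow_succ', Module.End.mul_apply]
      exact hle.trans (hT.realPart_mono ih)
  -- Lower bounds along orbits survive in `φ`: the bound `0` gives positivity, the bound `ψ |z|`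
  -- gives `φ |z| > 0`.
  have hφpos : ∀ x, 0 ≤ x → 0 ≤ φ x := fun x hx => hφ x 0 fun n => hψ _ (hpow n x hx)
  have hφu : 0 < φ (modulus z) := hψu.trans_le (hφ _ _ fun n => hψmono _ _ (hpowu n))
  obtain ⟨n, hn⟩ := hirr.exists_realPart_pow_pos hT (sub_nonneg.2 hle) (sub_ne_zero.2 hne)
    hφpos (by rintro rfl; simp at hφu)
  have hinv : ∀ n : ℕ, ∀ x, φ ((realPart T ^ n) x) = φ x := fun n x => by
    induction n with
    | zero => simp
    | succ n ih => rw [pow_succ', Module.End.mul_apply, hφS, ih]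
  rw [hinv, map_sub, hφS, sub_self] at hn
  exact hn.false

/-! ### Separating phases by truncation. -/

/-- A uniform gap between `2` and `|c + e|` for unimodular `c`, `e` that stay `r` apart. -/
theorem exists_norm_add_le_of_le_norm_sub {r : ℝ} (hr : 0 < r) :
    ∃ δ : ℝ, 0 < δ ∧ ∀ c e : ℂ, ‖c‖ = 1 → ‖e‖ = 1 → r ≤ ‖c - e‖ → ‖c + e‖ ≤ 2 - δ := by
  -- With `t = ‖c + e‖`, the parallelogram law gives `t² ≤ 4 - r²`, and `t ≤ 1 + t²/4 ≤ 2 - r²/4`;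
  -- any positive `δ ≤ r²/4` works.
  refine ⟨r ^ 2 / (4 + r ^ 2), by positivity, fun c e hc he h => ?_⟩
  have hpar := parallelogram_law_with_norm ℝ c e
  rw [hc, he] at hpar
  have h1 : r ^ 2 / (4 + r ^ 2) ≤ r ^ 2 / 4 := by gcongr; nlinarith
  have h2 : r ^ 2 ≤ ‖c - e‖ ^ 2 := by gcongr
  nlinarith [norm_nonneg (c + e), sq_nonneg (‖c + e‖ - 2)]

section Truncation

/-- The part of `|z|` that lives where `c z` is close to `|z|`. -/
noncomputable def nearPart (δ : ℝ) (c : ℂ) (z : LatticeComplexification X) : X :=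
  (δ • modulus z - (modulus z - (c • z).re))⁺

/-- A rearrangement of `Re ((c + e) z) ≤ ‖c + e‖ |z| ≤ (2 - δ) |z|`. -/
theorem nearPart_le {δ : ℝ} {c e : ℂ} (he : ‖e‖ = 1)
    (hce : ‖c + e‖ ≤ 2 - δ) (z : LatticeComplexification X) :
    nearPart δ c z ≤ modulus z - (e • z).re := by
  refine sup_le ?_ (sub_nonneg.2 (re_smul_le_modulus z he))
  have h : ((c + e) • z).re ≤ (2 - δ) • modulus z := by
    have h1 := (le_abs_self _).trans (abs_re_le_modulus ((c + e) • z))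
    rw [modulus_smul] at h1
    exact h1.trans (smul_le_smul_of_nonneg_right hce (modulus_nonneg z))
  rw [add_smul, add_re, sub_smul, two_smul] at h
  rw [← sub_nonneg] at h ⊢
  convert h using 1
  abel

/-- If `T z = μ z` with `μ ≠ 1` unimodular and `|z|` is fixed, then the operator moves the part
of `|z|` near `c z` to something disjoint. -/
theorem exists_nearPart_disjoint (hT : IsPositiveOperator T) {z : LatticeComplexification X}
    {μ : ℂ} (hμ : ‖μ‖ = 1) (hμ1 : μ ≠ 1) (hz : T z = μ • z)
    (hfix : realPart T (modulus z) = modulus z) :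
    ∃ δ : ℝ, 0 < δ ∧ ∀ c : ℂ, ‖c‖ = 1 →
      nearPart δ c z ⊓ realPart T (nearPart δ c z) ≤ 0 := by
  have hμ0 : μ ≠ 0 := by rintro rfl; simp at hμ
  obtain ⟨δ, hδ, hgap⟩ := exists_norm_add_le_of_le_norm_sub
    (half_pos (norm_pos_iff.2 (sub_ne_zero.2 hμ1)))
  refine ⟨δ, hδ, fun c hc => ?_⟩
  set h := nearPart δ c z ⊓ realPart T (nearPart δ c z)
  -- At least one of `e`, `e μ⁻¹` is at distance `‖μ - 1‖ / 2` or more from `c`. If `e` is, bound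
  -- the near part directly; otherwise bound it through `e μ⁻¹` and apply the operator, which turns
  -- `e μ⁻¹` into `e`.
  have key : ∀ e : ℂ, ‖e‖ = 1 → h ≤ modulus z - (e • z).re := by
    intro e he
    by_cases hce : ‖μ - 1‖ / 2 ≤ ‖c - e‖
    · exact inf_le_left.trans (nearPart_le he (hgap c e hc he hce) z)
    have he' : ‖e * μ⁻¹‖ = 1 := by simp [he, hμ]
    have hfar : ‖μ - 1‖ / 2 ≤ ‖c - e * μ⁻¹‖ := by
      have h1 : ‖c * (μ - 1)‖ ≤ ‖(c - e * μ⁻¹) * μ‖ + ‖c - e‖ := by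
        have : c * (μ - 1) = (c - e * μ⁻¹) * μ - (c - e) := by
          field_simp
          ring
        rw [this]
        exact norm_sub_le _ _
      rw [norm_mul, norm_mul, hc, hμ] at h1
      linarith [not_le.1 hce]
    have h2 := hT.realPart_mono (nearPart_le he' (hgap c _ hc he' hfar) z)
    rw [map_sub, hfix, hT.realPart_smul_re hz, inv_mul_cancel_right₀ hμ0] at h2
    exact inf_le_right.trans h2
  have hle : modulus z ≤ modulus z - h := by
    refine (isLUB_modulus z).2 ?_
    rintro _ ⟨e, he, rfl⟩
    exact le_sub_comm.1 (key e he)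
  exact le_sub_self_iff _ |>.1 hle

end Truncation

/-- Positive elements disjoint from `y` are not approximated by the principal ideal of `y`. -/
theorem eq_zero_of_mem_closure_principalIdeal {x y : X} (hx : 0 ≤ x) (hy : 0 ≤ y)
    (h : x ⊓ y = 0) (hxy : ofReal x ∈ closure (ofReal y).principalIdeal) : x = 0 := by
  refine norm_le_zero_iff.1 (le_of_forall_pos_le_add fun ε hε => ?_)
  obtain ⟨k, ⟨c, hc, hk⟩, hdist⟩ := Metric.mem_closure_iff.1 hxy ε hε
  have hk' : modulus k ≤ c • y := hk.1.trans_eq (coe_smul_re c _)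
  have hk0 : x ⊓ |k.re| = 0 :=
    le_antisymm ((inf_le_inf_left x ((abs_re_le_modulus k).trans hk')).trans
      (inf_smul_eq_zero hx hy h hc).le) (le_inf hx (abs_nonneg _))
  -- Both `· ⊓ x` and `|·|` are contractions, so disjointness from `k.re` gives `‖x‖ ≤ ‖x - k.re‖`.
  calc ‖x‖ = ‖|x| ⊓ x - |k.re| ⊓ x‖ := by
        rw [abs_of_nonneg hx, inf_idem, inf_comm, hk0, sub_zero]
    _ ≤ ‖|x| - |k.re|‖ := norm_inf_sub_inf_le_norm _ _ _
    _ ≤ ‖x - k.re‖ := norm_abs_sub_abs _ _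
    _ ≤ ‖ofReal x - k‖ := norm_re_le (ofReal x - k)
    _ ≤ 0 + ε := by rw [zero_add, ← dist_eq_norm]; exact hdist.le

end LatticeComplexification

/-! ### The main theorem. -/

open LatticeComplexification in
theorem theorem3p1 {X : Type*} [NormedAddCommGroup X] [NormedSpace ℝ X] [CompleteSpace X]
    [Lattice X] [IsOrderedAddMonoid X] [IsOrderedModule ℝ X] [HasSolidNorm X]
    (T : LatticeComplexification X →ₗ[ℂ] LatticeComplexification X)
    (hpos : LatticeComplexification.IsPositiveOperator T)
    (hwap : IsWeaklyAlmostPeriodic T)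
    (hirr : LatticeComplexification.IsIrreducibleOperator T)
    (hB : ∃ B : Submodule ℂ (LatticeComplexification X), B ≠ ⊥ ∧
      LatticeComplexification.IsProjectionBand B ∧
      ∀ f ∈ B, 0 ≤ f →
        closure f.principalIdeal ⊆ closure (T f).principalIdeal) :
    {μ : ℂ | Module.End.HasEigenvalue T μ} ∩ {μ : ℂ | ‖μ‖ = 1} ⊆ {1} := by
  rintro μ ⟨hev, hμ⟩
  by_contra hμ1
  obtain ⟨z, hzev⟩ := Module.End.HasEigenvalue.exists_hasEigenvector hev
  have hz : T z = μ • z := hzev.apply_eq_smul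
  have hu0 : modulus z ≠ 0 := fun h => hzev.2 (norm_eq_zero.1 (by rw [norm_def, h, norm_zero]))
  have hfix := realPart_modulus_eq hpos hwap hirr hμ hz
  obtain ⟨δ, hδ, hdisj⟩ := exists_nearPart_disjoint hpos hμ hμ1 hz hfix
  obtain ⟨B, hB0, ⟨P, -, rfl, hP⟩, hcl⟩ := hB
  have hPpos : IsPositiveOperator P.toLinearMap := fun f hf => (hP f hf).1
  set Q := realPart P.toLinearMap
  have hQle : ∀ x, 0 ≤ x → Q x ≤ x := fun x hx => (hP _ (ofReal_nonneg hx)).2.1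
  have hQnear : ∀ c : ℂ, ‖c‖ = 1 → Q (nearPart δ c z) = 0 := by
    intro c hc
    have hg : 0 ≤ nearPart δ c z := posPart_nonneg _
    have hf : 0 ≤ Q (nearPart δ c z) := hPpos.realPart_nonneg hg
    have hTf := hpos.realPart_nonneg hf
    have hfle := hQle _ hg
    -- Disjointness passes down from the near part and its image because `Q x ≤ x` for `x ≥ 0`.
    refine eq_zero_of_mem_closure_principalIdeal hf hTf (le_antisymm
      ((inf_le_inf hfle (hpos.realPart_mono hfle)).trans (hdisj c hc)) (le_inf hf hTf)) ?_
    rw [← hpos.apply_ofReal]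
    refine hcl _ ⟨ofReal (nearPart δ c z), hPpos.apply_ofReal _⟩ (ofReal_nonneg hf)
      (subset_closure ⟨1, zero_le_one, ?_⟩)
    refine ⟨?_, by simp⟩
    simpa [abs_of_nonneg hf] using modulus_le (ofReal (Q (nearPart δ c z)))
  have hle : modulus z ≤ modulus z - δ • Q (modulus z) := by
    refine (isLUB_modulus z).2 ?_
    rintro _ ⟨c, hc, rfl⟩
    -- Dropping the positive part and applying `Q` leaves `δ Q |z| ≤ Q (|z| - Re (c z)) ≤ |z| - Re
    -- (c z)`.
    have h1 := hPpos.realPart_mono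
      (le_posPart (δ • modulus z - (modulus z - (c • z).re)))
    have h2 := hQle _ (sub_nonneg.2 (re_smul_le_modulus z hc))
    change Q _ ≤ Q (nearPart δ c z) at h1
    rw [hQnear c hc, map_sub, map_smul, sub_nonpos] at h1
    exact le_sub_comm.1 (h1.trans h2)
  have hQu : Q (modulus z) = 0 := by
    refine le_antisymm ?_ (hPpos.realPart_nonneg (modulus_nonneg z))
    have h := smul_le_smul_of_nonneg_left ((le_sub_self_iff _).1 hle) (inv_pos.2 hδ).le
    rwa [smul_smul, inv_mul_cancel₀ hδ.ne', one_smul, smul_zero] at h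
  have hQ0 : ∃ x, 0 ≤ x ∧ Q x ≠ 0 := by
    by_contra! H
    have hQ : ∀ x, Q x = 0 := fun x => by
      rw [← posPart_sub_negPart x, map_sub, H _ (posPart_nonneg x), H _ (negPart_nonneg x),
        sub_zero]
    refine hB0 ((Submodule.eq_bot_iff _).2 ?_)
    rintro _ ⟨w, rfl⟩
    refine (hPpos.apply_eq w).trans ?_
    rw [hQ, hQ]
    rfl
  obtain ⟨x, hx, hQx⟩ := hQ0
  obtain ⟨ψ, hψ, hψx⟩ := exists_positive_functional_pos (hPpos.realPart_nonneg hx) hQx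
  -- The functional is nonzero at `x`, but vanishes at `|z|`, which is its own orbit.
  obtain ⟨n, hn⟩ := hirr.exists_realPart_pow_pos hpos (modulus_nonneg z) hu0 (φ := ψ ∘ₗ Q)
    (fun y hy => hψ _ (hPpos.realPart_nonneg hy))
    (fun h => hψx.ne' (LinearMap.congr_fun h x))
  have hpow : (realPart T ^ n) (modulus z) = modulus z := by
    clear hn
    induction n with
    | zero => simp
    | succ n ih => rw [pow_succ', Module.End.mul_apply, ih, hfix]
  rw [hpow, LinearMap.comp_apply, hQu, map_zero] at hn
  exact hn.false
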